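/- **Setting.** Let $\mathbb K$ be a field of characteristic zero, $A$ an associative unital $\mathbb K$-algebra, $\varphi:A\to\mathbb K$ a linear form with $\varphi(1_A)=1$, and $a_1,\dots,a_d\in A$. For a non-commutative formal power series $f=\sum_w f_w x_w$ in $x_1,\dots,x_d$, write $f(0)=f_\emptyset$, and let $\partial/\partial x_i$ be the planar derivative, the linear map with $\frac{\partial}{\partial x_i}(x_{i_1}\cdots x_{i_k})=\delta_{i,i_1}x_{i_2}\cdots x_{i_k}$ and $\frac{\partial}{\partial x_i}1=0$. Put $f_{x_{i_1}\cdots x_{i_k}}=\frac{\partial^k f}{\partial x_{i_k}\cdots\partial x_{i_1}}$ (the derivative with respect to $x_{i_1}$ is taken first), and write $f(0)_{x_{i_1}\cdots x_{i_k}}$ for its constant term, which is the coefficient $f_{i_1\cdots i_k}$. Let $\mathrm M(\mathbf x)=1+\sum_{q\ge1}\sum_{i_1,\dots,i_q}\varphi(a_{i_1}\cdots a_{i_q})\,x_{i_1}\cdots x_{i_q}$. Let $\mathrm K$ be the generating series of the free cumulants, i.e. the series defined by $\mathrm M(\mathbf x)=1+\mathrm K(x_1\mathrm M(\mathbf x),\dots,x_d\mathrm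 M(\mathbf x))$. It is viewed as a series $\mathrm K(\mathbf y)$ in the new variables $y_i=x_i\mathrm M(\mathbf x)$. Its conjugate field is $\Phi=(\phi_1,\dots,\phi_d)$, $\phi_i=\partial \mathrm K(\mathbf y)/\partial y_i$. Assume that $\Phi$ is regular: the $\phi_i$ have no constant term and the matrix $(\mathrm K(0)_{y_iy_j})_{i,j}$ is invertible. Let $\mathrm L$ be the effective action, i.e. the series $\mathrm L(\Phi)$ in $\phi_1,\dots,\phi_d$ with $\mathrm L(\Phi)=\sum_i\phi_iy_i$. Its derivatives $\mathrm L(\Phi)_{e_1\cdots e_k}=\frac{\partial^k}{\partial\phi_{e_k}\cdots\partial\phi_{e_1}}\mathrm L(\Phi)$ are regarded as series in $\mathbf y$ through $\phi_i=\phi_i(\mathbf y)$, and $\mathrm L(0)_{e_1\cdots e_k}\in\mathbb K$ are the coefficients of $\mathrm L$. We write $\mathrm K(\mathbf y)_{ab}$ for $\mathrm K(\mathbf y)_{y_ay_b}$ and $\mathrm K(0)_{ab}$ for $\mathrm K(0)_{y_ay_b}$. **Trees and Feynman rules.** Let $n\ge2$ and let $w=i_1\cdots i_n$ be a word with letters in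 $\{1,\dots,d\}$. A $w$-admissible tree is a planar rooted tree inscribed in a disk, with root and leaves on the boundary of the disk and internal vertices in its interior. Its root is incident to exactly one edge and is decorated by $i_1$; its $n-1$ leaves are decorated by $i_2,\dots,i_n$ in anti-clockwise order; and every internal vertex has arity (number of incident edges) at least $3$. The set of these trees is $\mathcal D_w$. The characteristic path of $T\in\mathcal D_w$ is the path from the root to the last leaf, the one decorated by $i_n$. To $T\in\mathcal D_w$ one associates a series $F(T)$ as follows. Assign a variable with values in $\{1,\dots,d\}$ to every half-edge at an internal vertex; the end of an edge at the root or at a leaf carries the decoration of the root or leaf. An internal vertex is assigned $\mathrm L(\Phi)_{e_1\cdots e_k}$ if it lies on the characteristic path and $\mathrm L(0)_{e_1\cdots e_k}$ otherwise, where $e_1,\dots,e_k$ are the variables around the vertex in anti-clockwise order, starting with the half-edge towards the root. An edge is assigned $\mathrm K(\mathbf y)_{ab}$ if it lies on the characteristic path and $\mathrm K(0)_{ab}$ otherwise, where $a$ is the label at the end closest to the root and $b$ the label at the other end. Multiply all these terms, the factors of the characteristic path being taken from left to right in the order in which they occur on the way from the last leaf to the root, and sum over all values of the variables. Then $F(T)$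 is $(-1)^p$ times this sum, where $p$ is the number of internal vertices of $T$. **Theorem.** The set $\mathcal D_w$ is finite. Deleting the root with its edge, and the decorations, gives a bijection from $\mathcal D_w$ onto the set of Schröder trees (planar rooted trees all of whose internal vertices have at least two descendants) with $n-1$ leaves. Moreover $$\mathrm K(\mathbf y)_{y_{i_1}\cdots y_{i_n}}=\frac{\partial^n\mathrm K(\mathbf y)}{\partial y_{i_n}\cdots\partial y_{i_1}}=\sum_{T\in\mathcal D_w}F(T).$$ -/

import Mathlib

/-- Non-commutative formal power series `𝕜⟨⟨x₁, …, x_d⟩⟩`: a series is the family of its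
coefficients, indexed by the words in the letters `Fin d` (the empty word gives the constant
term). -/
def NCSeries (𝕜 : Type*) (d : ℕ) : Type _ := List (Fin d) → 𝕜

namespace NCSeries

variable {𝕜 : Type*} [Field 𝕜] {d : ℕ}

instance : AddCommGroup (NCSeries 𝕜 d) := inferInstanceAs (AddCommGroup (List (Fin d) → 𝕜))

instance : Module 𝕜 (NCSeries 𝕜 d) := inferInstanceAs (Module 𝕜 (List (Fin d) → 𝕜))

/-- The coefficient `f_w` of the word `w`. -/
def coeff (f : NCSeries 𝕜 d) (w : List (Fin d)) : 𝕜 := f w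

/-- The series `1`. -/
instance : One (NCSeries 𝕜 d) := ⟨fun w => if w = [] then 1 else 0⟩

/-- The Cauchy product: sum over all ways to cut a word into a left and a right part. -/
instance : Mul (NCSeries 𝕜 d) :=
  ⟨fun f g w => ∑ k ∈ Finset.range (w.length + 1), f.coeff (w.take k) * g.coeff (w.drop k)⟩

/-- The variable `x_i`. -/
def X (i : Fin d) : NCSeries 𝕜 d := fun w => if w = [i] then 1 else 0

/-- The planar derivative `∂/∂x_i`, which strips a first letter `x_i` from each monomial
and kills the monomials that do not start with `x_i`. -/
def deriv (i : Fin d) (f : NCSeries 𝕜 d) : NCSeries 𝕜 d := fun w => f.coeff (i :: w)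

/-- The iterated derivative `f_{x_{i₁} ⋯ x_{i_k}} = ∂^k f / ∂x_{i_k} ⋯ ∂x_{i₁}`
(the derivative with respect to `x_{i₁}` is taken first). -/
def derivWord (f : NCSeries 𝕜 d) : List (Fin d) → NCSeries 𝕜 d
  | [] => f
  | i :: w => derivWord (deriv i f) w

/-- The product `g_{i₁} ⋯ g_{i_k}` of components of a field, for the word `i₁ ⋯ i_k`. -/
def wordProd (g : Fin d → NCSeries 𝕜 d) (w : List (Fin d)) : NCSeries 𝕜 d := (w.map g).prod

/-- The composition `f ∘ g = ∑_w f_w g_w`, for a field `g` without constant terms. The words `w`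
longer than `u` do not contribute to the coefficient of `u`, see `coeff_wordProd_of_lt`. -/
def comp (f : NCSeries 𝕜 d) (g : Fin d → NCSeries 𝕜 d) : NCSeries 𝕜 d := fun u =>
  ∑ k ∈ Finset.range (u.length + 1), ∑ v : Fin k → Fin d,
    f.coeff (List.ofFn v) * (wordProd g (List.ofFn v)).coeff u

/-- The integral field `(x₁ f, …, x_d f)` of `f`. -/
def integralField (f : NCSeries 𝕜 d) : Fin d → NCSeries 𝕜 d := fun i => X i * f

/-- The matrix of the linear part of a field. -/
def linearPart (g : Fin d → NCSeries 𝕜 d) : Matrix (Fin d) (Fin d) 𝕜 :=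
  Matrix.of fun i j => (g i).coeff [j]

theorem coeff_one_nil : (1 : NCSeries 𝕜 d).coeff [] = 1 := by
  change (if ([] : List (Fin d)) = [] then (1 : 𝕜) else 0) = 1
  simp

theorem coeff_mul (f g : NCSeries 𝕜 d) (w : List (Fin d)) :
    (f * g).coeff w =
      ∑ k ∈ Finset.range (w.length + 1), f.coeff (w.take k) * g.coeff (w.drop k) := rfl

theorem coeff_wordProd_cons (g : Fin d → NCSeries 𝕜 d) (hg : ∀ i, (g i).coeff [] = 0)
    (i j : Fin d) (w u : List (Fin d)) (h : u.length ≤ w.length)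
    (hlt : ∀ v : List (Fin d), v.length < w.length → (wordProd g w).coeff v = 0) :
    (wordProd g (i :: w)).coeff (j :: u) = (g i).coeff [j] * (wordProd g w).coeff u := by
  have : wordProd g (i :: w) = g i * wordProd g w := by simp [wordProd]
  rw [this, coeff_mul, Finset.sum_eq_single 1]
  · simp
  · intro k hk hk1
    rcases k with _ | _ | k
    · simp [hg]
    · exact absurd rfl hk1
    · simp only [List.length_cons, Finset.mem_range] at hk
      rw [List.drop_succ_cons, hlt, mul_zero]
      simp only [List.length_drop]
      omega
  · simp

/-- Without constant terms, `g_w` has no monomials of length less than `w`. -/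
theorem coeff_wordProd_of_lt (g : Fin d → NCSeries 𝕜 d) (hg : ∀ i, (g i).coeff [] = 0)
    (w : List (Fin d)) : ∀ u : List (Fin d), u.length < w.length →
      (wordProd g w).coeff u = 0 := by
  induction w with
  | nil => intro u hu; simp at hu
  | cons i w ih =>
    intro u hu
    rcases u with _ | ⟨j, u⟩
    · have : wordProd g (i :: w) = g i * wordProd g w := by simp [wordProd]
      rw [this, coeff_mul]
      simp [hg]
    · simp only [List.length_cons] at hu
      rw [coeff_wordProd_cons g hg i j w u (by omega) ih, ih u (by omega), mul_zero]

theorem coeff_wordProd_ofFn (g : Fin d → NCSeries 𝕜 d) (hg : ∀ i, (g i).coeff [] = 0)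
    (n : ℕ) (v u : Fin n → Fin d) :
    (wordProd g (List.ofFn v)).coeff (List.ofFn u) = ∏ j, linearPart g (v j) (u j) := by
  induction n with
  | zero =>
    simp only [List.ofFn_zero, Finset.univ_eq_empty, Finset.prod_empty, wordProd, List.map_nil,
      List.prod_nil]
    exact coeff_one_nil
  | succ n ih =>
    rw [List.ofFn_succ, List.ofFn_succ, coeff_wordProd_cons g hg _ _ _ _ (by simp)
      (coeff_wordProd_of_lt g hg _), ih, Fin.prod_univ_succ]
    rfl

/-- The coefficient of `u` in the part of `f ∘ g` that comes from words shorter than `u`. -/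
def compLower (f : NCSeries 𝕜 d) (g : Fin d → NCSeries 𝕜 d) (u : List (Fin d)) : 𝕜 :=
  ∑ k ∈ Finset.range u.length, ∑ v : Fin k → Fin d,
    f.coeff (List.ofFn v) * (wordProd g (List.ofFn v)).coeff u

theorem coeff_comp (f : NCSeries 𝕜 d) (g : Fin d → NCSeries 𝕜 d)
    (hg : ∀ i, (g i).coeff [] = 0) (n : ℕ) (u : Fin n → Fin d) :
    (f.comp g).coeff (List.ofFn u) = compLower f g (List.ofFn u) +
      ∑ v : Fin n → Fin d, f.coeff (List.ofFn v) * ∏ j, linearPart g (v j) (u j) := by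
  change ∑ k ∈ Finset.range ((List.ofFn u).length + 1), ∑ v : Fin k → Fin d,
    f.coeff (List.ofFn v) * (wordProd g (List.ofFn v)).coeff (List.ofFn u) = _
  rw [Finset.sum_range_succ]
  congr 1
  rw [List.length_ofFn]
  exact Finset.sum_congr rfl fun v _ => by rw [coeff_wordProd_ofFn g hg]

theorem sum_prod_inv (G H : Matrix (Fin d) (Fin d) 𝕜) (h : G * H = 1) (n : ℕ)
    (u w : Fin n → Fin d) :
    ∑ v : Fin n → Fin d, (∏ j, G (u j) (v j)) * ∏ j, H (v j) (w j) = if u = w then 1 else 0 := by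
  simp_rw [← Finset.prod_mul_distrib]
  rw [← Fintype.prod_sum (fun j i => G (u j) i * H i (w j))]
  have : ∀ j, ∑ i, G (u j) i * H i (w j) = if u j = w j then 1 else 0 := fun j => by
    rw [← Matrix.mul_apply, h, Matrix.one_apply]
  simp_rw [this]
  split_ifs with huw
  · simp [huw]
  · obtain ⟨j, hj⟩ := Function.ne_iff.mp huw
    exact Finset.prod_eq_zero (Finset.mem_univ j) (if_neg hj)

/-- The recursive solution `f` of `f ∘ g = h`. -/
noncomputable def solve (g : Fin d → NCSeries 𝕜 d) (h : NCSeries 𝕜 d) (w : List (Fin d)) : 𝕜 :=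
  ∑ u : Fin w.length → Fin d,
    (h.coeff (List.ofFn u) - ∑ k : Fin w.length, ∑ v : Fin k → Fin d,
      solve g h (List.ofFn v) * (wordProd g (List.ofFn v)).coeff (List.ofFn u)) *
    ∏ j, (linearPart g)⁻¹ (u j) (w.get j)
termination_by w.length
decreasing_by simp

theorem solve_ofFn (g : Fin d → NCSeries 𝕜 d) (h : NCSeries 𝕜 d) (n : ℕ) (w : Fin n → Fin d) :
    solve g h (List.ofFn w) = ∑ u : Fin n → Fin d,
      (h.coeff (List.ofFn u) - compLower (solve g h) g (List.ofFn u)) *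
        ∏ j, (linearPart g)⁻¹ (u j) (w j) := by
  have key : ∀ (l : List (Fin d)) (hl : l.length = n), (∀ j, l.get (j.cast hl.symm) = w j) →
      solve g h l = ∑ u : Fin n → Fin d,
      (h.coeff (List.ofFn u) - compLower (solve g h) g (List.ofFn u)) *
        ∏ j, (linearPart g)⁻¹ (u j) (w j) := by
    intro l hl hw
    subst hl
    rw [solve]
    refine Finset.sum_congr rfl fun u _ => ?_
    congr 1
    · congr 1
      unfold compLower
      rw [List.length_ofFn]
      exact Fin.sum_univ_eq_sum_range (fun k => ∑ v : Fin k → Fin d,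
        solve g h (List.ofFn v) * (wordProd g (List.ofFn v)).coeff (List.ofFn u)) _
    · exact Finset.prod_congr rfl fun j _ => by rw [← hw j]; rfl
  exact key _ List.length_ofFn (by simp)

/-- If the field `g` has no constant terms and an invertible linear part, every series `h` can be
written in exactly one way as a series in the new variables `g₁, …, g_d`. -/
theorem existsUnique_comp_eq (g : Fin d → NCSeries 𝕜 d) (hg : ∀ i, (g i).coeff [] = 0)
    (hG : IsUnit (linearPart g)) (h : NCSeries 𝕜 d) : ∃! f : NCSeries 𝕜 d, f.comp g = h := by
  have hdet : IsUnit (linearPart g).det := (Matrix.isUnit_iff_isUnit_det _).mp hG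
  refine ⟨solve g h, ?_, ?_⟩
  · funext w
    obtain ⟨n, u, rfl⟩ : ∃ (n : ℕ) (u : Fin n → Fin d), w = List.ofFn u :=
      ⟨w.length, w.get, (List.ofFn_get w).symm⟩
    refine (coeff_comp _ g hg n u).trans ?_
    have : ∀ v : Fin n → Fin d, coeff (solve g h) (List.ofFn v) = ∑ u : Fin n → Fin d,
      (h.coeff (List.ofFn u) - compLower (solve g h) g (List.ofFn u)) *
        ∏ j, (linearPart g)⁻¹ (u j) (v j) := solve_ofFn g h n
    simp_rw [this, Finset.sum_mul]
    rw [Finset.sum_comm]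
    simp_rw [mul_assoc, ← Finset.mul_sum]
    simp_rw [sum_prod_inv _ _ (Matrix.nonsing_inv_mul _ hdet)]
    simp [coeff]
  · intro f hf
    have main : ∀ (n : ℕ) (w : Fin n → Fin d), f.coeff (List.ofFn w) = solve g h (List.ofFn w) := by
      intro n
      induction n using Nat.strong_induction_on with
      | _ n ih =>
      intro w
      rw [solve_ofFn]
      have h1 : ∀ u : Fin n → Fin d,
          h.coeff (List.ofFn u) - compLower (solve g h) g (List.ofFn u) =
          ∑ v : Fin n → Fin d, f.coeff (List.ofFn v) * ∏ j, linearPart g (v j) (u j) := by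
        intro u
        have h2 : compLower (solve g h) g (List.ofFn u) = compLower f g (List.ofFn u) := by
          unfold compLower
          refine Finset.sum_congr rfl fun k hk => Finset.sum_congr rfl fun v _ => ?_
          rw [ih k (by simpa using hk) v]
          rfl
        rw [h2, ← hf, coeff_comp f g hg]
        ring
      simp_rw [h1, Finset.sum_mul]
      rw [Finset.sum_comm]
      simp_rw [mul_assoc, ← Finset.mul_sum]
      simp_rw [sum_prod_inv _ _ (Matrix.mul_nonsing_inv _ hdet)]
      simp
    funext w
    have := main w.length w.get
    rw [List.ofFn_get] at this
    exact this

/-- The series `f` such that `f ∘ g = h`, that is, `h` rewritten as a formal power series in the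
new variables `g₁, …, g_d`. By `existsUnique_comp_eq` it exists and is unique if `g` has no
constant terms and an invertible linear part. -/
noncomputable def rewriteIn (g : Fin d → NCSeries 𝕜 d) (h : NCSeries 𝕜 d) : NCSeries 𝕜 d :=
  Classical.epsilon fun f => f.comp g = h

theorem rewriteIn_comp (g : Fin d → NCSeries 𝕜 d) (hg : ∀ i, (g i).coeff [] = 0)
    (hG : IsUnit (linearPart g)) (h : NCSeries 𝕜 d) : (rewriteIn g h).comp g = h :=
  Classical.epsilon_spec (existsUnique_comp_eq g hg hG h).exists

end NCSeries

section FreeProbability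

variable {𝕜 : Type*} [Field 𝕜] {d : ℕ}

open NCSeries

/-- The generating series `M(x)` of the multivariate moments `φ(a_{i₁} ⋯ a_{i_q})`. -/
def momentSeries {A : Type*} [Ring A] [Algebra 𝕜 A] (φ : A →ₗ[𝕜] 𝕜) (a : Fin d → A) :
    NCSeries 𝕜 d := fun w => φ (w.map a).prod

/-- The generating series `K` of the free cumulants attached to a moment series `M`, defined by
`M(x) = 1 + K(x M(x))`, see `speicher_formula`. -/
noncomputable def cumulantSeries (M : NCSeries 𝕜 d) : NCSeries 𝕜 d :=
  rewriteIn (integralField M) (M - 1)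

/-- The conjugate field `Φ = (φ₁, …, φ_d)`, `φ_i = ∂K/∂y_i`, as series in the variables `y`. -/
def conjugateField (K : NCSeries 𝕜 d) : Fin d → NCSeries 𝕜 d := fun i => deriv i K

/-- The covariance matrix `(k^{(2)}_{ij})`. -/
def covariance (K : NCSeries 𝕜 d) : Matrix (Fin d) (Fin d) 𝕜 :=
  Matrix.of fun i j => K.coeff [i, j]

/-- The conjugate field is regular: it has no constant part and the covariance matrix is
invertible. -/
def IsRegularConjugateField (K : NCSeries 𝕜 d) : Prop :=
  (∀ i, (conjugateField K i).coeff [] = 0) ∧ IsUnit (covariance K)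

/-- The effective action (Legendre transform of `K`): the series `L` such that
`L(Φ) = ∑ i, φ_i y_i`, where `Φ` is the conjugate field. -/
noncomputable def effectiveAction (K : NCSeries 𝕜 d) : NCSeries 𝕜 d :=
  rewriteIn (conjugateField K) (∑ i, conjugateField K i * X i)

theorem coeff_integralField (M : NCSeries 𝕜 d) (i j : Fin d) (u : List (Fin d)) :
    (integralField M i).coeff (j :: u) = if i = j then M.coeff u else 0 := by
  rw [integralField, coeff_mul, Finset.sum_eq_single 1]
  · simp [coeff, X, eq_comm]
  · rintro (_ | _ | k) hk hk1
    · simp [coeff, X]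
    · exact absurd rfl hk1
    · rcases u with _ | ⟨m, u⟩
      · simp at hk
      · simp [coeff, X]
  · simp

/-- The functional equation that relates moments and free cumulants. -/
theorem speicher_formula (M : NCSeries 𝕜 d) (hM : M.coeff [] = 1) :
    M = 1 + (cumulantSeries M).comp (integralField M) := by
  have h : (cumulantSeries M).comp (integralField M) = M - 1 := by
    refine rewriteIn_comp _ (fun i => ?_) ?_ _
    · rw [integralField, coeff_mul]
      simp [coeff, X]
    · have : linearPart (integralField M) = 1 := by
        ext i j
        simp [linearPart, coeff_integralField, hM, Matrix.one_apply]
      rw [this]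
      exact isUnit_one
  rw [h]
  abel

/-- For a regular conjugate field, `L(Φ) = ∑ i, φ_i y_i`. -/
theorem effectiveAction_comp (K : NCSeries 𝕜 d) (hK : IsRegularConjugateField K) :
    (effectiveAction K).comp (conjugateField K) = ∑ i, conjugateField K i * X i :=
  rewriteIn_comp _ hK.1 hK.2 _

end FreeProbability

/-- Planar trees with decorated leaves. `node k c` is an internal vertex with the `k` subtrees
`c 0, …, c (k - 1)` above it, in planar (anti-clockwise) order, starting after the edge towards
the root. -/
inductive PlanarTree (α : Type*) : Type _
  | leaf (b : α) : PlanarTree α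
  | node (k : ℕ) (c : Fin k → PlanarTree α) : PlanarTree α

namespace PlanarTree

variable {α β : Type*}

/-- The leaf decorations, in anti-clockwise order. -/
def leaves : PlanarTree α → List α
  | leaf b => [b]
  | node _ c => (List.ofFn fun j => (c j).leaves).flatten

/-- The number of internal vertices. -/
def numInternal : PlanarTree α → ℕ
  | leaf _ => 0
  | node _ c => 1 + ∑ j, (c j).numInternal

/-- Every internal vertex has at least two descendants. -/
def IsSchroeder : PlanarTree α → Prop
  | leaf _ => True
  | node k c => 2 ≤ k ∧ ∀ j, (c j).IsSchroeder

/-- Every internal vertex has arity at least three, where the arity is the number of all edges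
at the vertex, including the edge towards the root. -/
def ArityGeThree : PlanarTree α → Prop
  | leaf _ => True
  | node k c => 3 ≤ k + 1 ∧ ∀ j, (c j).ArityGeThree

/-- Change of the leaf decorations. -/
def map (f : α → β) : PlanarTree α → PlanarTree β
  | leaf b => leaf (f b)
  | node k c => node k fun j => (c j).map f

/-- The half-edges at the internal vertices of a tree. At the lowest internal vertex `none` is the
half-edge towards the root and `some j` the one towards the `j`-th subtree. -/
def HalfEdge : PlanarTree α → Type
  | leaf _ => Empty
  | node k c => Option (Fin k) ⊕ (Σ j : Fin k, (c j).HalfEdge)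

instance decidableEqHalfEdge : (T : PlanarTree α) → DecidableEq T.HalfEdge
  | leaf _ => inferInstanceAs (DecidableEq Empty)
  | node k c =>
    haveI := fun j => decidableEqHalfEdge (c j)
    inferInstanceAs (DecidableEq (Option (Fin k) ⊕ (Σ j : Fin k, (c j).HalfEdge)))

instance fintypeHalfEdge : (T : PlanarTree α) → Fintype T.HalfEdge
  | leaf _ => inferInstanceAs (Fintype Empty)
  | node k c =>
    haveI := fun j => fintypeHalfEdge (c j)
    inferInstanceAs (Fintype (Option (Fin k) ⊕ (Σ j : Fin k, (c j).HalfEdge)))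

/-- An assignment of a variable to each half-edge at an internal vertex. -/
abbrev Labelling (T : PlanarTree α) (β : Type*) : Type _ := T.HalfEdge → β

/-- The label at the lowest vertex, on the half-edge towards the root. -/
def Labelling.down {k : ℕ} {c : Fin k → PlanarTree α} (e : Labelling (node k c) β) : β :=
  e (Sum.inl none)

/-- The label at the lowest vertex, on the half-edge towards the `j`-th subtree. -/
def Labelling.up {k : ℕ} {c : Fin k → PlanarTree α} (e : Labelling (node k c) β)
    (j : Fin k) : β :=
  e (Sum.inl (some j))

/-- The labelling of the `j`-th subtree. -/
def Labelling.sub {k : ℕ} {c : Fin k → PlanarTree α} (e : Labelling (node k c) β)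
    (j : Fin k) : Labelling (c j) β :=
  fun h => e (Sum.inr ⟨j, h⟩)

/-- The labels around the lowest vertex, in anti-clockwise order, starting with the half-edge
towards the root. -/
def Labelling.around {k : ℕ} {c : Fin k → PlanarTree α} (e : Labelling (node k c) β) : List β :=
  e.down :: List.ofFn e.up

end PlanarTree

/-- The Schröder trees with `m` leaves. -/
def schroederTrees (m : ℕ) : Set (PlanarTree Unit) :=
  {t | t.IsSchroeder ∧ t.leaves.length = m}

/-- Planar rooted trees with decorated root and leaves. The root is a point of the boundary of the
disk; one edge joins it to the rest of the tree. -/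
structure RootedPlanarTree (α : Type*) where
  root : α
  top : PlanarTree α

namespace RootedPlanarTree

/-- The decorations of the root and of the leaves, in anti-clockwise order along the boundary of
the disk. -/
def boundary {α : Type*} (T : RootedPlanarTree α) : List α := T.root :: T.top.leaves

/-- The tree without its root (and root edge) and without the decorations. -/
def shape {α : Type*} (T : RootedPlanarTree α) : PlanarTree Unit := T.top.map fun _ => ()

end RootedPlanarTree

/-- The set `D_w` of `w`-admissible trees, `w = i₁ ⋯ i_n`: the root is decorated by `i₁`, the
`n - 1` leaves by `i₂, …, i_n` in anti-clockwise order, and all internal vertices have arity at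
least three. -/
def admissibleTrees {α : Type*} (w : List α) : Set (RootedPlanarTree α) :=
  {T | T.boundary = w ∧ T.top.ArityGeThree}

section FeynmanRules

variable {𝕜 : Type*} [Field 𝕜] {d : ℕ} (K : NCSeries 𝕜 d)

open PlanarTree NCSeries

/-- The 1PI correlation functional `L(Φ)_{e₁ ⋯ e_k}`, as a series in the variables `y`. -/
noncomputable def onePIFunctional (e : List (Fin d)) : NCSeries 𝕜 d :=
  ((effectiveAction K).derivWord e).comp (conjugateField K)

/-- The 1PI coefficient `L(0)_{e₁ ⋯ e_k}`. -/
noncomputable def onePICoeff (e : List (Fin d)) : 𝕜 := (effectiveAction K).coeff e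

/-- The product of the scalars of a subtree that does not meet the characteristic path: a factor
`K(0)_{ab}` for each edge (including the edge below the subtree, whose label closest to the root
is `a`) and a factor `L(0)_{e₁ ⋯ e_k}` for each internal vertex. -/
noncomputable def offPathScalar : (T : PlanarTree (Fin d)) → Fin d → Labelling T (Fin d) → 𝕜
  | .leaf b, a, _ => K.coeff [a, b]
  | .node _ c, a, e => K.coeff [a, Labelling.down e] * onePICoeff K (Labelling.around e) *
      ∏ j, offPathScalar (c j) (Labelling.up e j) (Labelling.sub e j)

/-- The product of the scalars of all edges and vertices off the characteristic path, which is the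
path from the root to the last leaf; it passes to the last subtree at each vertex. -/
noncomputable def pathScalar : (T : PlanarTree (Fin d)) → Labelling T (Fin d) → 𝕜
  | .leaf _, _ => 1
  | .node 0 _, _ => 1
  | .node (k + 1) c, e =>
      (∏ j : Fin k, offPathScalar K (c j.castSucc) (Labelling.up e j.castSucc)
        (Labelling.sub e j.castSucc)) * pathScalar (c (Fin.last k)) (Labelling.sub e (Fin.last k))

/-- The functionals of the edges (`K(y)_{ab}`) and vertices (`L(Φ)_{e₁ ⋯ e_k}`) of the
characteristic path, listed from the last leaf to the root; `a` is the label closest to the root on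
the edge below the tree. -/
noncomputable def pathFactors :
    (T : PlanarTree (Fin d)) → Fin d → Labelling T (Fin d) → List (NCSeries 𝕜 d)
  | .leaf b, a, _ => [K.derivWord [a, b]]
  | .node 0 _, a, e => [onePIFunctional K (Labelling.around e), K.derivWord [a, Labelling.down e]]
  | .node (k + 1) c, a, e =>
      pathFactors (c (Fin.last k)) (Labelling.up e (Fin.last k)) (Labelling.sub e (Fin.last k)) ++
        [onePIFunctional K (Labelling.around e), K.derivWord [a, Labelling.down e]]

/-- The Feynman rules: `F(T)` is `(-1)^p`, with `p` the number of internal vertices, times the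
sum over all values of the variables on the half-edges of the monomial of `T`. -/
noncomputable def feynman (T : RootedPlanarTree (Fin d)) : NCSeries 𝕜 d :=
  ((-1 : 𝕜) ^ T.top.numInternal) • ∑ e : Labelling T.top (Fin d),
    pathScalar K T.top e • (pathFactors K T.top T.root e).prod

end FeynmanRules

/-! The engine is one identity differentiated repeatedly. The Legendre transform inverts the
conjugate field, ∂L/∂φ_b(Φ) = y_b (`onePIFunctional_singleton`). The planar Faà di Bruno formula
gives, for a nonempty word v, (L(Φ)_p)_v = Σ_e K_{ev} L(Φ)_{pe} + Σ_{v = v'v''} Σ_e K(0)_{ev'}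
(L(Φ)_{pe})_{v''}, with v', v'' nonempty (`derivWord_onePIFunctional`).

Take p = b. If |v| = 1, the left side is a Kronecker delta, so the Hessians of K and L are inverse
matrices. If |v| ≥ 2, the left side vanishes; multiplying by K_{ab} on the right and summing over b
isolates K_{av}, as minus a sum over the cuts of v.

This is the recursion of trees. Removing the root edge and the lowest vertex leaves a forest of at
least two trees. Its first tree misses the characteristic path and contributes only its constant
term K(0)_{ev'}; the remaining forest accounts for (L(Φ)_{be})_{v''}. Hence
`finsum_feynman_and_forestSum` proves together, by induction on |v|, that trees sum to K_{av} and
forests to (L(Φ)_p)_v. -/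

namespace NCSeries

variable {𝕜 : Type*} [Field 𝕜] {d : ℕ}

/-! ### The ring of non-commutative series and its planar derivatives -/

@[ext]
theorem ext_coeff {f g : NCSeries 𝕜 d} (h : ∀ w, f.coeff w = g.coeff w) : f = g := funext h

@[simp]
theorem coeff_add (f g : NCSeries 𝕜 d) (w : List (Fin d)) :
    (f + g).coeff w = f.coeff w + g.coeff w := rfl

@[simp]
theorem coeff_zero (w : List (Fin d)) : (0 : NCSeries 𝕜 d).coeff w = 0 := rfl

@[simp]
theorem coeff_smul (c : 𝕜) (f : NCSeries 𝕜 d) (w : List (Fin d)) :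
    (c • f).coeff w = c * f.coeff w := rfl

/-- The coefficient of a fixed word, as an additive map. -/
def coeffHom (w : List (Fin d)) : NCSeries 𝕜 d →+ 𝕜 where
  toFun f := f.coeff w
  map_zero' := rfl
  map_add' _ _ := rfl

theorem coeff_sum {ι : Type*} (s : Finset ι) (f : ι → NCSeries 𝕜 d) (w : List (Fin d)) :
    (∑ i ∈ s, f i).coeff w = ∑ i ∈ s, (f i).coeff w :=
  map_sum (coeffHom w) f s

theorem coeff_cons (f : NCSeries 𝕜 d) (i : Fin d) (w : List (Fin d)) :
    f.coeff (i :: w) = (deriv i f).coeff w := rfl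

@[simp]
theorem coeff_mul_nil (f g : NCSeries 𝕜 d) : (f * g).coeff [] = f.coeff [] * g.coeff [] := by
  simp [coeff_mul]

theorem deriv_one (i : Fin d) : deriv i (1 : NCSeries 𝕜 d) = 0 := by
  funext w
  change (if i :: w = [] then (1 : 𝕜) else 0) = 0
  simp

/-- The Leibniz rule of the planar derivative. -/
theorem deriv_mul (i : Fin d) (f g : NCSeries 𝕜 d) :
    deriv i (f * g) = deriv i f * g + f.coeff [] • deriv i g := by
  ext w
  rw [← coeff_cons, coeff_mul, coeff_add, coeff_mul, List.length_cons, Finset.sum_range_succ']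
  simp [coeff_cons]

theorem add_mul_aux (f g h : NCSeries 𝕜 d) : (f + g) * h = f * h + g * h := by
  ext w
  simp [coeff_mul, add_mul, Finset.sum_add_distrib]

theorem mul_add_aux (f g h : NCSeries 𝕜 d) : f * (g + h) = f * g + f * h := by
  ext w
  simp [coeff_mul, mul_add, Finset.sum_add_distrib]

theorem smul_mul_aux (c : 𝕜) (f g : NCSeries 𝕜 d) : (c • f) * g = c • (f * g) := by
  ext w
  simp [coeff_mul, Finset.mul_sum, mul_assoc]

theorem mul_smul_aux (c : 𝕜) (f g : NCSeries 𝕜 d) : f * (c • g) = c • (f * g) := by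
  ext w
  simp [coeff_mul, Finset.mul_sum, mul_left_comm]

theorem zero_mul_aux (f : NCSeries 𝕜 d) : 0 * f = 0 := by
  ext w
  simp [coeff_mul]

theorem mul_zero_aux (f : NCSeries 𝕜 d) : f * 0 = 0 := by
  ext w
  simp [coeff_mul]

/-- The Leibniz rule strips the first letter of the word, so induction on the word replaces the
reindexing of a double Cauchy sum. -/
theorem mul_assoc_aux (f g h : NCSeries 𝕜 d) : f * g * h = f * (g * h) := by
  ext w
  induction w generalizing f g h with
  | nil => simp [mul_assoc]
  | cons i w ih =>
    simp only [coeff_cons, deriv_mul, add_mul_aux, smul_mul_aux, coeff_add,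
      coeff_smul, coeff_mul_nil, ih]
    ring

theorem one_mul_aux (f : NCSeries 𝕜 d) : 1 * f = f := by
  ext w
  cases w with
  | nil => simp [coeff_one_nil]
  | cons i w => simp [coeff_cons, deriv_mul, deriv_one, zero_mul_aux, coeff_one_nil]

theorem mul_one_aux (f : NCSeries 𝕜 d) : f * 1 = f := by
  ext w
  induction w generalizing f with
  | nil => simp [coeff_one_nil]
  | cons i w ih => simp [coeff_cons, deriv_mul, deriv_one, ih]

/-- The ring of non-commutative formal power series. -/
abbrev ring : Ring (NCSeries 𝕜 d) :=
  { (inferInstance : AddCommGroup (NCSeries 𝕜 d)) with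
    -- The operations are those already declared, so the products in `wordProd` and `feynman` are
    -- products in this ring.
    mul := (· * ·)
    one := 1
    left_distrib := mul_add_aux
    right_distrib := add_mul_aux
    zero_mul := zero_mul_aux
    mul_zero := mul_zero_aux
    mul_assoc := mul_assoc_aux
    one_mul := one_mul_aux
    mul_one := mul_one_aux }

attribute [local instance] NCSeries.ring

instance : IsScalarTower 𝕜 (NCSeries 𝕜 d) (NCSeries 𝕜 d) := ⟨smul_mul_aux⟩

instance : SMulCommClass 𝕜 (NCSeries 𝕜 d) (NCSeries 𝕜 d) :=
  ⟨fun c f g => (mul_smul_aux c f g).symm⟩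

theorem deriv_sum {ι : Type*} (i : Fin d) (s : Finset ι) (f : ι → NCSeries 𝕜 d) :
    deriv i (∑ j ∈ s, f j) = ∑ j ∈ s, deriv i (f j) := by
  ext w
  simp [← coeff_cons, coeff_sum]

@[simp]
theorem coeff_X_nil (i : Fin d) : (X i : NCSeries 𝕜 d).coeff [] = 0 := by
  simp [coeff, X]

theorem deriv_X (i j : Fin d) : deriv j (X i : NCSeries 𝕜 d) = if i = j then 1 else 0 := by
  funext w
  change (if j :: w = [i] then (1 : 𝕜) else 0) = _
  by_cases h : i = j
  · subst h
    simp only [List.cons.injEq, true_and, if_true]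
    rfl
  · rw [if_neg h, if_neg (by simp [Ne.symm h])]
    rfl

theorem derivWord_append (f : NCSeries 𝕜 d) (u v : List (Fin d)) :
    f.derivWord (u ++ v) = (f.derivWord u).derivWord v := by
  induction u generalizing f with
  | nil => rfl
  | cons i u ih => exact ih _

theorem coeff_derivWord (f : NCSeries 𝕜 d) (u v : List (Fin d)) :
    (f.derivWord u).coeff v = f.coeff (u ++ v) := by
  induction u generalizing f with
  | nil => rfl
  | cons i u ih => exact ih _

theorem derivWord_add (f g : NCSeries 𝕜 d) (u : List (Fin d)) :
    (f + g).derivWord u = f.derivWord u + g.derivWord u := by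
  ext w
  simp [coeff_derivWord]

theorem derivWord_smul (c : 𝕜) (f : NCSeries 𝕜 d) (u : List (Fin d)) :
    (c • f).derivWord u = c • f.derivWord u := by
  ext w
  simp [coeff_derivWord]

theorem derivWord_zero (u : List (Fin d)) : (0 : NCSeries 𝕜 d).derivWord u = 0 := by
  ext w
  simp [coeff_derivWord]

theorem derivWord_sum {ι : Type*} (s : Finset ι) (f : ι → NCSeries 𝕜 d) (u : List (Fin d)) :
    (∑ j ∈ s, f j).derivWord u = ∑ j ∈ s, (f j).derivWord u := by
  ext w
  simp [coeff_derivWord, coeff_sum]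

theorem derivWord_one {u : List (Fin d)} (hu : u ≠ []) : (1 : NCSeries 𝕜 d).derivWord u = 0 := by
  cases u with
  | nil => exact absurd rfl hu
  | cons i u => exact (congrArg (derivWord · u) (deriv_one i)).trans (derivWord_zero u)

theorem derivWord_X (i : Fin d) {u : List (Fin d)} (hu : 2 ≤ u.length) :
    (X i : NCSeries 𝕜 d).derivWord u = 0 := by
  match u, hu with
  | j :: k :: u, _ =>
    change (deriv j (X i)).derivWord (k :: u) = 0
    rw [deriv_X]
    split_ifs
    · exact derivWord_one (by simp)
    · exact derivWord_zero _

/-- The iterated Leibniz rule. -/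
theorem derivWord_mul (f g : NCSeries 𝕜 d) (v : List (Fin d)) :
    (f * g).derivWord v = f.derivWord v * g +
      ∑ k ∈ Finset.range v.length, f.coeff (v.take k) • g.derivWord (v.drop k) := by
  induction v generalizing f g with
  | nil => simp [derivWord]
  | cons i v ih =>
    change (deriv i (f * g)).derivWord v = (deriv i f).derivWord v * g + _
    rw [deriv_mul, derivWord_add, derivWord_smul, ih, List.length_cons, Finset.sum_range_succ',
      add_assoc]
    rfl

/-- The iterated Leibniz rule, for a left factor without constant term. -/
theorem derivWord_mul_of_coeff_nil {f : NCSeries 𝕜 d} (hf : f.coeff [] = 0) (g : NCSeries 𝕜 d)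
    (v : List (Fin d)) :
    (f * g).derivWord v = f.derivWord v * g +
      ∑ k ∈ Finset.Ico 1 v.length, f.coeff (v.take k) • g.derivWord (v.drop k) := by
  rw [derivWord_mul]
  congr 1
  rcases Nat.eq_zero_or_pos v.length with h | h
  · simp [h]
  · rw [Finset.range_eq_Ico, Finset.sum_eq_sum_Ico_succ_bot h]
    simp [hf]

/-! ### Composition, Faà di Bruno formula and matrices of series -/

/-- The part of `f ∘ g` that comes from words of length less than `N`. -/
def compTrunc (N : ℕ) (f : NCSeries 𝕜 d) (g : Fin d → NCSeries 𝕜 d) : NCSeries 𝕜 d :=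
  ∑ k ∈ Finset.range N, ∑ v : Fin k → Fin d, f.coeff (List.ofFn v) • wordProd g (List.ofFn v)

/-- In `comp` the range of summation depends on the coefficient. A truncation is a genuine finite
sum in the ring, and the extra words are too long to contribute. -/
theorem coeff_compTrunc (f : NCSeries 𝕜 d) {g : Fin d → NCSeries 𝕜 d}
    (hg : ∀ i, (g i).coeff [] = 0) {N : ℕ} {u : List (Fin d)} (h : u.length < N) :
    (compTrunc N f g).coeff u = (f.comp g).coeff u := by
  simp only [compTrunc, coeff_sum, coeff_smul]
  refine (Finset.sum_subset (s₁ := Finset.range (u.length + 1)) ?_ ?_).symm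
  · intro k
    simp only [Finset.mem_range]
    omega
  · intro k _ hk
    refine Finset.sum_eq_zero fun v _ => ?_
    rw [coeff_wordProd_of_lt g hg, mul_zero]
    simp only [Finset.mem_range, List.length_ofFn] at hk ⊢
    omega

theorem compTrunc_succ (N : ℕ) (f : NCSeries 𝕜 d) (g : Fin d → NCSeries 𝕜 d) :
    compTrunc (N + 1) f g = f.coeff [] • 1 + ∑ i, g i * compTrunc N (deriv i f) g := by
  rw [compTrunc, Finset.sum_range_succ', add_comm]
  congr 1
  · simp [wordProd]
  · simp only [compTrunc, Finset.mul_sum]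
    rw [Finset.sum_comm]
    refine Finset.sum_congr rfl fun k _ => ?_
    rw [← (Fin.consEquiv fun _ : Fin (k + 1) => Fin d).sum_comp, Fintype.sum_prod_type]
    refine Finset.sum_congr rfl fun i _ => Finset.sum_congr rfl fun v _ => ?_
    simp [Fin.consEquiv, List.ofFn_succ, wordProd, coeff_cons, mul_smul_comm]

/-- Substitution of g into f = f(0) + Σ x_i ∂_i f. -/
theorem comp_eq (f : NCSeries 𝕜 d) {g : Fin d → NCSeries 𝕜 d} (hg : ∀ i, (g i).coeff [] = 0) :
    f.comp g = f.coeff [] • 1 + ∑ i, g i * (deriv i f).comp g := by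
  ext u
  -- The truncation is at |u| + 2: splitting off a first letter leaves |u| + 1, still enough for
  -- every suffix of u.
  rw [← coeff_compTrunc f hg (u.length.lt_succ_self.trans (Nat.lt_succ_self _)), compTrunc_succ,
    coeff_add, coeff_add, coeff_sum, coeff_sum]
  congr 1
  refine Finset.sum_congr rfl fun i _ => ?_
  rw [coeff_mul, coeff_mul]
  refine Finset.sum_congr rfl fun k _ => ?_
  rw [coeff_compTrunc _ hg]
  simp only [List.length_drop]
  omega

theorem coeff_comp_nil (f : NCSeries 𝕜 d) {g : Fin d → NCSeries 𝕜 d}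
    (hg : ∀ i, (g i).coeff [] = 0) : (f.comp g).coeff [] = f.coeff [] := by
  rw [comp_eq f hg]
  simp [coeff_sum, coeff_one_nil, hg]

/-- The Faà di Bruno formula of the planar derivatives, in recursive form. -/
theorem derivWord_comp (f : NCSeries 𝕜 d) {g : Fin d → NCSeries 𝕜 d}
    (hg : ∀ i, (g i).coeff [] = 0) {v : List (Fin d)} (hv : v ≠ []) :
    (f.comp g).derivWord v = ∑ i, (g i).derivWord v * (deriv i f).comp g +
      ∑ k ∈ Finset.Ico 1 v.length, ∑ i,
        (g i).coeff (v.take k) • ((deriv i f).comp g).derivWord (v.drop k) := by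
  rw [comp_eq f hg, derivWord_add, derivWord_smul, derivWord_one hv, smul_zero, zero_add,
    derivWord_sum, Finset.sum_comm, ← Finset.sum_add_distrib]
  exact Finset.sum_congr rfl fun i _ => derivWord_mul_of_coeff_nil (hg i) _ v

theorem comp_injective {g : Fin d → NCSeries 𝕜 d} (hg : ∀ i, (g i).coeff [] = 0)
    (hG : IsUnit (linearPart g)) {f f' : NCSeries 𝕜 d} (h : f.comp g = f'.comp g) : f = f' :=
  (existsUnique_comp_eq g hg hG (f'.comp g)).unique h rfl

/-- A matrix of series with invertible constant part is left regular. -/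
theorem matrix_eq_zero_of_mul_eq_zero {P N : Matrix (Fin d) (Fin d) (NCSeries 𝕜 d)}
    (hP : IsUnit (P.map fun f => f.coeff [])) (h : P * N = 0) : N = 0 := by
  have key : ∀ (m : ℕ) (w : List (Fin d)), w.length = m → N.map (fun f => f.coeff w) = 0 := by
    intro m
    induction m using Nat.strong_induction_on with
    | _ m ih =>
    intro w hw
    have h0 : P.map (fun f => f.coeff []) * N.map (fun f => f.coeff w) = 0 := by
      ext i j
      have hij : ((P * N) i j).coeff w = 0 := by rw [h]; rfl
      rw [Matrix.mul_apply, coeff_sum] at hij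
      rw [Matrix.mul_apply, Matrix.zero_apply, ← hij]
      refine Finset.sum_congr rfl fun e _ => ?_
      -- Only P(0) N_w survives: the other terms involve coefficients of N at shorter words, which
      -- vanish by induction.
      rw [coeff_mul, Finset.sum_eq_single 0]
      · rfl
      · intro k hk hk0
        have : (N e j).coeff (w.drop k) = 0 := by
          refine congrFun (congrFun (ih (w.drop k).length ?_ _ rfl) e) j
          simp only [Finset.mem_range, List.length_drop] at hk ⊢
          omega
        rw [this, mul_zero]
      · simp
    exact hP.mul_right_eq_zero.mp h0
  ext i j w
  exact congrFun (congrFun (key _ w rfl) i) j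

/-- The entries do not commute, so determinants are unavailable; instead P is cancelled on the left
in P(QP - 1) = 0. -/
theorem matrix_mul_eq_one_comm {P Q : Matrix (Fin d) (Fin d) (NCSeries 𝕜 d)}
    (hP : IsUnit (P.map fun f => f.coeff [])) (h : P * Q = 1) : Q * P = 1 := by
  have : P * (Q * P - 1) = 0 := by rw [mul_sub, ← mul_assoc, h, one_mul, mul_one, sub_self]
  exact sub_eq_zero.mp (matrix_eq_zero_of_mul_eq_zero hP this)

end NCSeries

/-! ### The Legendre transform -/

section LegendreTransform

attribute [local instance] NCSeries.ring

variable {𝕜 : Type*} [Field 𝕜] {d : ℕ} {K : NCSeries 𝕜 d}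

open NCSeries

/-- The Legendre transform inverts the conjugate field: `∂L/∂φ_i (Φ) = y_i`. -/
theorem onePIFunctional_singleton (hK : IsRegularConjugateField K) (i : Fin d) :
    onePIFunctional K [i] = X i := by
  -- N_i is y_i as a series in φ. Then F = Σ φ_i N_i has planar derivatives N_i and satisfies the
  -- equation defining L, so L = F by uniqueness.
  let N : Fin d → NCSeries 𝕜 d := fun i => rewriteIn (conjugateField K) (X i)
  have hN : ∀ i, (N i).comp (conjugateField K) = X i := fun i =>
    rewriteIn_comp _ hK.1 hK.2 _
  let F : NCSeries 𝕜 d := ∑ i, X i * N i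
  have hF : ∀ i, deriv i F = N i := fun i => by
    simp [F, NCSeries.deriv_sum, NCSeries.deriv_mul, deriv_X]
  have hF0 : F.coeff [] = 0 := by simp [F, coeff_sum]
  have : effectiveAction K = F := by
    refine comp_injective hK.1 hK.2 ?_
    rw [effectiveAction_comp K hK, comp_eq F hK.1, hF0, zero_smul, zero_add]
    simp [hF, hN]
  change (deriv i (effectiveAction K)).comp (conjugateField K) = X i
  rw [this, hF, hN]

theorem coeff_onePIFunctional_nil (hK : IsRegularConjugateField K) (p : List (Fin d)) :
    (onePIFunctional K p).coeff [] = onePICoeff K p := by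
  rw [onePIFunctional, coeff_comp_nil _ hK.1, coeff_derivWord, List.append_nil, onePICoeff]

theorem derivWord_onePIFunctional (hK : IsRegularConjugateField K) (p : List (Fin d))
    {v : List (Fin d)} (hv : v ≠ []) :
    (onePIFunctional K p).derivWord v =
      ∑ e, K.derivWord (e :: v) * onePIFunctional K (p ++ [e]) +
      ∑ k ∈ Finset.Ico 1 v.length, ∑ e,
        (K.derivWord (e :: v.take k)).coeff [] •
          (onePIFunctional K (p ++ [e])).derivWord (v.drop k) := by
  rw [onePIFunctional, derivWord_comp _ hK.1 hv]
  simp only [onePIFunctional, derivWord_append, coeff_derivWord, List.append_nil]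
  rfl

/-- The Hessians of K and L are inverse. Differentiating y_i = L(Φ)_i once gives PQ = 1, whereas
isolating K_{av} needs QP = 1. -/
theorem sum_onePIFunctional_mul (hK : IsRegularConjugateField K) (a e : Fin d) :
    ∑ b, onePIFunctional K [b, e] * K.derivWord [a, b] = if e = a then 1 else 0 := by
  let P : Matrix (Fin d) (Fin d) (NCSeries 𝕜 d) := Matrix.of fun j e => K.derivWord [e, j]
  let Q : Matrix (Fin d) (Fin d) (NCSeries 𝕜 d) := Matrix.of fun e i => onePIFunctional K [i, e]
  -- The constant part of P is the transposed covariance matrix.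
  have hP : IsUnit (P.map fun f => f.coeff []) := (Matrix.isUnit_transpose _).mpr hK.2
  have hPQ : P * Q = 1 := by
    ext1 j i
    have h := derivWord_onePIFunctional hK [i] (v := [j]) (by simp)
    rw [onePIFunctional_singleton hK] at h
    simp only [List.length_singleton, Finset.Ico_self, Finset.sum_empty, add_zero] at h
    rw [Matrix.mul_apply, Matrix.one_apply]
    refine h.symm.trans ((deriv_X i j).trans ?_)
    simp only [eq_comm]
  have := congrFun (congrFun (matrix_mul_eq_one_comm hP hPQ) e) a
  rwa [Matrix.mul_apply, Matrix.one_apply] at this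

end LegendreTransform

/-! ### Combinatorics of planar trees and forests -/

theorem List.exists_flatten_eq {α : Type*} (lens : List ℕ) (v : List α)
    (h : lens.sum = v.length) : ∃ ls : List (List α), ls.map List.length = lens ∧ ls.flatten = v := by
  induction lens generalizing v with
  | nil => exact ⟨[], rfl, by simpa [eq_comm] using h⟩
  | cons n lens ih =>
    rw [List.sum_cons] at h
    obtain ⟨ls, h1, h2⟩ := ih (v.drop n) (by rw [List.length_drop]; omega)
    refine ⟨v.take n :: ls, ?_, ?_⟩
    · rw [List.map_cons, h1, List.length_take, Nat.min_eq_left (by omega)]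
    · rw [List.flatten_cons, h2, List.take_append_drop]

namespace PlanarTree

variable {α β : Type*}

theorem leaves_map (f : α → β) (T : PlanarTree α) : (T.map f).leaves = T.leaves.map f := by
  induction T with
  | leaf b => rfl
  | node k c ih => simp [map, leaves, ih, List.map_flatten, List.map_ofFn, Function.comp_def]

theorem isSchroeder_map (f : α → β) (T : PlanarTree α) :
    (T.map f).IsSchroeder ↔ T.ArityGeThree := by
  induction T with
  | leaf b => rfl
  | node k c ih =>
    simp only [map, IsSchroeder, ArityGeThree, ih]
    exact and_congr_left' (by omega)

/-- A tree is determined by its shape and its leaf decorations. -/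
theorem eq_of_map_eq_of_leaves_eq {f : α → Unit} {T T' : PlanarTree α} (h : T.map f = T'.map f)
    (hl : T.leaves = T'.leaves) : T = T' := by
  induction T generalizing T' with
  | leaf b =>
    cases T' with
    | leaf b' => simpa [leaves] using hl
    | node k' c' => simp [map] at h
  | node k c ih =>
    cases T' with
    | leaf b' => simp [map] at h
    | node k' c' =>
      simp only [map, node.injEq] at h
      obtain ⟨rfl, h⟩ := h
      have h' : ∀ j, (c j).map f = (c' j).map f := fun j => congrFun (eq_of_heq h) j
      have hlen : ∀ j, (c j).leaves.length = (c' j).leaves.length := fun j => by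
        have := congrArg (fun t : PlanarTree Unit => t.leaves.length) (h' j)
        simpa [leaves_map] using this
      have : (List.ofFn fun j => (c j).leaves) = List.ofFn fun j => (c' j).leaves := by
        -- Equal shapes have equal leaf counts in each subtree, so the common leaf word is cut at
        -- the same places.
        refine (List.eq_iff_flatten_eq).mpr ⟨hl, ?_⟩
        simp [List.map_ofFn, Function.comp_def, hlen]
      have := List.ofFn_injective this
      congr 1
      funext j
      exact ih j (h' j) (congrFun this j)

/-- The leaves of a tree can be decorated by any word of the right length. -/
theorem exists_map_eq (f : α → Unit) (t : PlanarTree Unit) (v : List α)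
    (h : t.leaves.length = v.length) : ∃ T : PlanarTree α, T.map f = t ∧ T.leaves = v := by
  induction t generalizing v with
  | leaf b =>
    simp only [leaves, List.length_singleton] at h
    obtain ⟨x, rfl⟩ := List.length_eq_one_iff.mp h.symm
    exact ⟨leaf x, rfl, rfl⟩
  | node k c ih =>
    simp only [leaves, List.length_flatten, List.map_ofFn] at h
    obtain ⟨ls, h1, h2⟩ := List.exists_flatten_eq _ v h
    have hk : ls.length = k := by simpa using congrArg List.length h1
    subst hk
    have h3 : ∀ j, (c j).leaves.length = (ls.get j).length := fun j => by
      have : List.ofFn (fun j => (ls.get j).length) = List.ofFn (List.length ∘ fun j => (c j).leaves) := by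
        rw [← h1]
        simp [List.ofFn_getElem_eq_map]
      exact (congrFun (List.ofFn_injective this) j).symm
    choose T hT hT' using fun j => ih j (ls.get j) (h3 j)
    refine ⟨node ls.length T, ?_, ?_⟩
    · simp only [map, hT]
    · simp only [leaves, hT', List.ofFn_get, h2]

/-- Following first subtrees upwards ends at a leaf. This makes all cuts of a leaf word proper, so
inductions on its length descend. -/
theorem ArityGeThree.leaves_ne_nil {T : PlanarTree α} (h : T.ArityGeThree) : T.leaves ≠ [] := by
  induction T with
  | leaf b => simp [leaves]
  | node k c ih =>
    obtain ⟨hk, hc⟩ := h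
    simp only [leaves, ne_eq, List.flatten_eq_nil_iff, List.forall_mem_ofFn_iff, not_forall]
    exact ⟨⟨0, by omega⟩, ih _ (hc _)⟩

/-- The trees with leaf word `v` and internal vertices of arity at least three. -/
def treesWithLeaves (v : List α) : Set (PlanarTree α) := {T | T.leaves = v ∧ T.ArityGeThree}

/-- The nonempty planar forests with leaf word `v` and internal vertices of arity at least
three. -/
def forestsWithLeaves (v : List α) : Set (List (PlanarTree α)) :=
  {ts | ts ≠ [] ∧ (∀ T ∈ ts, T.ArityGeThree) ∧ (ts.map leaves).flatten = v}

/-- The forests of at least two trees among `forestsWithLeaves v`. -/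
def properForestsWithLeaves (v : List α) : Set (List (PlanarTree α)) :=
  {ts | ts ∈ forestsWithLeaves v ∧ 2 ≤ ts.length}

theorem singleton_mem_forestsWithLeaves {v : List α} {T : PlanarTree α} :
    [T] ∈ forestsWithLeaves v ↔ T ∈ treesWithLeaves v := by
  simp [forestsWithLeaves, treesWithLeaves, and_comm]

/-- The two pieces match the two sums in `derivWord_onePIFunctional`. -/
theorem forestsWithLeaves_eq (v : List α) :
    forestsWithLeaves v = (fun T => [T]) '' treesWithLeaves v ∪ properForestsWithLeaves v := by
  ext ts
  constructor
  · intro h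
    match ts, h with
    | [], h => exact absurd rfl h.1
    | [T], h => exact Or.inl ⟨T, singleton_mem_forestsWithLeaves.mp h, rfl⟩
    | T :: T' :: ts, h => exact Or.inr ⟨h, by simp⟩
  · rintro (⟨T, hT, rfl⟩ | h)
    · exact singleton_mem_forestsWithLeaves.mpr hT
    · exact h.1

theorem flatten_leaves_ne_nil {v : List α} {ts : List (PlanarTree α)}
    (h : ts ∈ forestsWithLeaves v) : v ≠ [] := by
  obtain ⟨h0, h1, rfl⟩ := h
  obtain ⟨T, hT⟩ := List.exists_mem_of_ne_nil ts h0
  intro h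
  rw [List.flatten_eq_nil_iff] at h
  exact (h1 T hT).leaves_ne_nil (h _ (List.mem_map_of_mem hT))

theorem cons_mem_properForestsWithLeaves {v : List α} {k : ℕ} {T : PlanarTree α}
    {ts : List (PlanarTree α)} (hT : T ∈ treesWithLeaves (v.take k))
    (hts : ts ∈ forestsWithLeaves (v.drop k)) : T :: ts ∈ properForestsWithLeaves v := by
  refine ⟨⟨by simp, ?_, ?_⟩, ?_⟩
  · simpa using ⟨hT.2, hts.2.1⟩
  · rw [List.map_cons, List.flatten_cons, hT.1, hts.2.2, List.take_append_drop]
  · have := List.length_pos_of_ne_nil hts.1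
    simp only [List.length_cons]
    omega

/-- The cut k is the number of leaves of the first tree. -/
theorem exists_cons_of_mem_properForestsWithLeaves {v : List α} {us : List (PlanarTree α)}
    (h : us ∈ properForestsWithLeaves v) : ∃ k ∈ Finset.Ico 1 v.length,
      ∃ T ∈ treesWithLeaves (v.take k), ∃ ts ∈ forestsWithLeaves (v.drop k), T :: ts = us := by
  match us, h with
  | T :: T' :: ts, h =>
    obtain ⟨⟨-, h1, h2⟩, -⟩ := h
    rw [List.map_cons, List.flatten_cons] at h2
    have hT := h1 T (by simp)
    have hts : T' :: ts ∈ forestsWithLeaves (((T' :: ts).map leaves).flatten) :=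
      ⟨by simp, fun t ht => h1 t (List.mem_cons_of_mem _ ht), rfl⟩
    have hpos := List.length_pos_of_ne_nil hT.leaves_ne_nil
    have hpos' := List.length_pos_of_ne_nil (flatten_leaves_ne_nil hts)
    refine ⟨T.leaves.length, ?_, T, ⟨?_, hT⟩, T' :: ts, ?_, rfl⟩
    · rw [← h2, Finset.mem_Ico, List.length_append]
      omega
    · rw [← h2, List.take_left']
      rfl
    · rw [← h2, List.drop_left']
      · exact hts
      · rfl

theorem treesWithLeaves_singleton (b : α) : treesWithLeaves [b] = {leaf b} := by
  ext T
  constructor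
  · rintro ⟨h, hT⟩
    cases T with
    | leaf b' => simpa [leaves] using h
    | node k c =>
      exfalso
      obtain ⟨hk, hc⟩ := hT
      have hl : ∑ j, (c j).leaves.length = 1 := by
        have := congrArg List.length h
        simpa [leaves, List.length_flatten, List.map_ofFn, List.sum_ofFn] using this
      have : ∑ _j : Fin k, 1 ≤ ∑ j, (c j).leaves.length :=
        Finset.sum_le_sum fun j _ => List.length_pos_of_ne_nil (hc j).leaves_ne_nil
      simp only [Finset.sum_const, Finset.card_univ, Fintype.card_fin, smul_eq_mul] at this
      omega
  · rintro rfl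
    exact ⟨rfl, trivial⟩

/-- The tree whose lowest vertex carries a given forest. -/
def graft (ts : List (PlanarTree α)) : PlanarTree α := node ts.length ts.get

theorem graft_ofFn {k : ℕ} (c : Fin k → PlanarTree α) : graft (List.ofFn c) = node k c := by
  have : ∀ (n : ℕ) (h : n = k), node n (fun j => c (j.cast h)) = node k c := by
    rintro n rfl
    rfl
  rw [← this _ List.length_ofFn, graft]
  congr 1
  funext j
  simp
  rfl

theorem graft_injective : Function.Injective (graft : List (PlanarTree α) → PlanarTree α) := by
  intro ts ts' h
  rw [← List.ofFn_get ts, ← List.ofFn_get ts']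
  rw [graft, graft, node.injEq] at h
  obtain ⟨h1, h2⟩ := h
  exact List.ofFn_inj'.mpr (Sigma.ext h1 h2)

/-- Two letters rule out a bare leaf, and arity at least three at the lowest vertex means at least
two trees above it. -/
theorem image_graft {v : List α} (hv : 2 ≤ v.length) :
    graft '' properForestsWithLeaves v = treesWithLeaves v := by
  ext T
  constructor
  · rintro ⟨ts, ⟨⟨h0, h1, h2⟩, h3⟩, rfl⟩
    refine ⟨?_, by omega, fun j => h1 _ (List.get_mem ts j)⟩
    rw [← h2, graft, leaves]
    congr 1
    exact List.ofFn_getElem_eq_map ts leaves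
  · rintro ⟨h, hT⟩
    cases T with
    | leaf b => simp [← h, leaves] at hv
    | node k c =>
      obtain ⟨hk, hc⟩ := hT
      refine ⟨List.ofFn c, ⟨⟨?_, ?_, ?_⟩, ?_⟩, graft_ofFn c⟩
      · rw [ne_eq, List.ofFn_eq_nil_iff]
        omega
      · simpa [List.forall_mem_ofFn_iff] using hc
      · rw [← h, leaves, List.map_ofFn]
        rfl
      · rw [List.length_ofFn]
        omega

theorem finite_properForestsWithLeaves_of {v : List α}
    (h : ∀ u : List α, u.length < v.length →
      (treesWithLeaves u).Finite ∧ (forestsWithLeaves u).Finite) :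
    (properForestsWithLeaves v).Finite := by
  refine Set.Finite.subset (s := ⋃ k ∈ Finset.Ico 1 v.length,
    Set.image2 List.cons (treesWithLeaves (v.take k)) (forestsWithLeaves (v.drop k))) ?_ ?_
  · refine Set.Finite.biUnion (Finset.finite_toSet _) fun k hk => ?_
    rw [Finset.mem_coe, Finset.mem_Ico] at hk
    refine Set.Finite.image2 _ (h _ ?_).1 (h _ ?_).2
    · rw [List.length_take]
      omega
    · rw [List.length_drop]
      omega
  · intro us hus
    obtain ⟨k, hk, T, hT, ts, hts, rfl⟩ := exists_cons_of_mem_properForestsWithLeaves hus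
    exact Set.mem_biUnion hk (Set.mem_image2_of_mem hT hts)

theorem finite_treesWithLeaves_and (v : List α) :
    (treesWithLeaves v).Finite ∧ (forestsWithLeaves v).Finite := by
  induction hn : v.length using Nat.strong_induction_on generalizing v with
  | _ n ih =>
  subst hn
  have hp := finite_properForestsWithLeaves_of fun u hu => ih _ hu u rfl
  have ht : (treesWithLeaves v).Finite := by
    match v with
    | [] =>
      refine Set.finite_empty.subset fun T hT => ?_
      exact hT.2.leaves_ne_nil hT.1
    | [b] =>
      rw [treesWithLeaves_singleton]
      exact Set.finite_singleton _
    | a :: b :: v =>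
      rw [← image_graft (by simp)]
      exact hp.image _
  refine ⟨ht, ?_⟩
  rw [forestsWithLeaves_eq]
  exact (ht.image _).union hp

theorem finite_treesWithLeaves (v : List α) : (treesWithLeaves v).Finite :=
  (finite_treesWithLeaves_and v).1

theorem finite_forestsWithLeaves (v : List α) : (forestsWithLeaves v).Finite :=
  (finite_treesWithLeaves_and v).2

theorem finite_properForestsWithLeaves (v : List α) : (properForestsWithLeaves v).Finite :=
  finite_properForestsWithLeaves_of fun u _ => finite_treesWithLeaves_and u

section Sums

variable {M : Type*} [AddCommMonoid M]

theorem finsum_treesWithLeaves {v : List α} (hv : 2 ≤ v.length) (F : PlanarTree α → M) :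
    ∑ᶠ T ∈ treesWithLeaves v, F T = ∑ᶠ ts ∈ properForestsWithLeaves v, F (graft ts) := by
  rw [← image_graft hv, finsum_mem_image graft_injective.injOn]

theorem finsum_forestsWithLeaves (v : List α) (F : List (PlanarTree α) → M) :
    ∑ᶠ ts ∈ forestsWithLeaves v, F ts =
      ∑ᶠ T ∈ treesWithLeaves v, F [T] + ∑ᶠ ts ∈ properForestsWithLeaves v, F ts := by
  rw [forestsWithLeaves_eq, finsum_mem_union _ ((finite_treesWithLeaves v).image _)
    (finite_properForestsWithLeaves v), finsum_mem_image]
  · intro T _ T' _ h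
    simpa using h
  · rw [Set.disjoint_left]
    rintro _ ⟨T, -, rfl⟩ h
    simpa using h.2

theorem finsum_properForestsWithLeaves (v : List α) (F : List (PlanarTree α) → M) :
    ∑ᶠ ts ∈ properForestsWithLeaves v, F ts = ∑ k ∈ Finset.Ico 1 v.length,
      ∑ᶠ T ∈ treesWithLeaves (v.take k), ∑ᶠ ts ∈ forestsWithLeaves (v.drop k), F (T :: ts) := by
  simp only [finsum_mem_eq_finite_toFinset_sum _ (finite_treesWithLeaves _),
    finsum_mem_eq_finite_toFinset_sum _ (finite_forestsWithLeaves _),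
    finsum_mem_eq_finite_toFinset_sum _ (finite_properForestsWithLeaves _)]
  simp_rw [← Finset.sum_product']
  rw [Finset.sum_sigma']
  symm
  refine Finset.sum_bij (fun x _ => x.2.1 :: x.2.2) ?_ ?_ ?_ ?_
  · rintro ⟨k, T, ts⟩ h
    simp only [Finset.mem_sigma, Finset.mem_product, Set.Finite.mem_toFinset] at h ⊢
    exact cons_mem_properForestsWithLeaves h.2.1 h.2.2
  · rintro ⟨k, T, ts⟩ h ⟨k', T', ts'⟩ h' heq
    simp only [Finset.mem_sigma, Finset.mem_product, Set.Finite.mem_toFinset,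
      Finset.mem_Ico] at h h'
    simp only [List.cons.injEq] at heq
    obtain ⟨rfl, rfl⟩ := heq
    -- The leaf count of the common first tree recovers the cut.
    have := congrArg List.length (h.2.1.1.symm.trans h'.2.1.1)
    simp only [List.length_take] at this
    have : k = k' := by omega
    subst this
    rfl
  · intro us h
    rw [Set.Finite.mem_toFinset] at h
    obtain ⟨k, hk, T, hT, ts, hts, rfl⟩ := exists_cons_of_mem_properForestsWithLeaves h
    exact ⟨⟨k, T, ts⟩, by simp_all, rfl⟩
  · intro _ _
    rfl

end Sums

end PlanarTree

/-! ### Admissible trees and Schröder trees -/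

section AdmissibleTrees

variable {α : Type*}

open PlanarTree

theorem admissibleTrees_cons (a : α) (v : List α) :
    admissibleTrees (a :: v) = RootedPlanarTree.mk a '' treesWithLeaves v := by
  ext ⟨r, T⟩
  simp only [admissibleTrees, RootedPlanarTree.boundary, Set.mem_ofPred_eq, List.cons.injEq,
    Set.mem_image, treesWithLeaves, RootedPlanarTree.mk.injEq]
  constructor
  · rintro ⟨⟨rfl, h⟩, hT⟩
    exact ⟨T, ⟨h, hT⟩, rfl, rfl⟩
  · rintro ⟨T', ⟨h, hT⟩, rfl, rfl⟩
    exact ⟨⟨rfl, h⟩, hT⟩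

theorem bijOn_shape (a : α) (v : List α) :
    Set.BijOn RootedPlanarTree.shape (admissibleTrees (a :: v)) (schroederTrees v.length) := by
  rw [admissibleTrees_cons]
  refine ⟨?_, ?_, ?_⟩
  · rintro _ ⟨T, ⟨h, hT⟩, rfl⟩
    exact ⟨(isSchroeder_map _ T).mpr hT, by simp [RootedPlanarTree.shape, leaves_map, h]⟩
  · rintro _ ⟨T, ⟨h, hT⟩, rfl⟩ _ ⟨T', ⟨h', hT'⟩, rfl⟩ heq
    exact congrArg _ (eq_of_map_eq_of_leaves_eq heq (h.trans h'.symm))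
  · rintro t ⟨ht, hl⟩
    obtain ⟨T, rfl, hT⟩ := exists_map_eq (fun _ : α => ()) t v hl
    exact ⟨⟨a, T⟩, ⟨T, ⟨hT, (isSchroeder_map _ T).mp ht⟩, rfl⟩, rfl⟩

end AdmissibleTrees

/-! ### Sums over trees and forests -/

section FeynmanSums

attribute [local instance] NCSeries.ring

variable {𝕜 : Type*} [Field 𝕜] {d : ℕ} (K : NCSeries 𝕜 d)

open PlanarTree NCSeries

theorem prod_append_pair {R : Type*} [Ring R] (l : List R) (x y : R) :
    (l ++ [x, y]).prod = l.prod * x * y := by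
  simp [mul_assoc]

variable {K} in
-- Taking constant terms is multiplicative and turns K(y)_{ab} and L(Φ)_e into K(0)_{ab} and L(0)_e.
theorem coeff_pathFactors_prod_nil (hK : IsRegularConjugateField K) (T : PlanarTree (Fin d))
    (a : Fin d) (e : Labelling T (Fin d)) :
    pathScalar K T e * ((pathFactors K T a e).prod).coeff [] = offPathScalar K T a e := by
  induction T generalizing a with
  | leaf b => simp [pathScalar, pathFactors, offPathScalar, coeff_derivWord]
  | node k c ih =>
    match k with
    | 0 =>
      simp [pathScalar, pathFactors, offPathScalar, coeff_derivWord,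
        coeff_onePIFunctional_nil hK, mul_comm]
    | k + 1 =>
      rw [pathScalar, pathFactors, offPathScalar, Fin.prod_univ_castSucc, ← ih (Fin.last k),
        prod_append_pair, coeff_mul_nil, coeff_mul_nil, coeff_onePIFunctional_nil hK,
        coeff_derivWord, List.append_nil]
      ring

variable {K} in
/-- The constant term of `F(T)` is the scalar of `T` as a tree off the characteristic path. -/
theorem coeff_feynman_nil (hK : IsRegularConjugateField K) (T : PlanarTree (Fin d)) (a : Fin d) :
    (feynman K ⟨a, T⟩).coeff [] =
      (-1) ^ T.numInternal * ∑ e : Labelling T (Fin d), offPathScalar K T a e := by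
  simp only [feynman, coeff_smul, coeff_sum, coeff_pathFactors_prod_nil hK]

/-- The sum of the monomials of a forest grafted onto a vertex of the characteristic path, where
`p` lists the labels at this vertex before those towards the forest. -/
noncomputable def forestSum : List (PlanarTree (Fin d)) → List (Fin d) → NCSeries 𝕜 d
  -- A default value: the forests summed over are nonempty.
  | [], _ => 0
  | [T], p => ∑ e, feynman K ⟨e, T⟩ * onePIFunctional K (p ++ [e])
  | T :: T' :: ts, p => ∑ e, (feynman K ⟨e, T⟩).coeff [] • forestSum (T' :: ts) (p ++ [e])

theorem forestSum_cons (T : PlanarTree (Fin d)) {ts : List (PlanarTree (Fin d))} (h : ts ≠ [])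
    (p : List (Fin d)) : forestSum K (T :: ts) p =
      ∑ e, (feynman K ⟨e, T⟩).coeff [] • forestSum K ts (p ++ [e]) := by
  match ts, h with
  | T' :: ts, _ => rfl

/-- The recursion unrolled: the characteristic path enters only the last tree, and the others enter
through constant terms. -/
theorem forestSum_ofFn (k : ℕ) (c : Fin (k + 1) → PlanarTree (Fin d)) (p : List (Fin d)) :
    forestSum K (List.ofFn c) p = ∑ f : Fin (k + 1) → Fin d,
      (∏ j : Fin k, (feynman K ⟨f j.castSucc, c j.castSucc⟩).coeff []) •
        (feynman K ⟨f (Fin.last k), c (Fin.last k)⟩ * onePIFunctional K (p ++ List.ofFn f)) := by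
  induction k generalizing p with
  | zero =>
    rw [← (Equiv.funUnique (Fin 1) (Fin d)).symm.sum_comp]
    simp [forestSum]
  | succ k ih =>
    rw [List.ofFn_succ, forestSum_cons _ _ (by simp),
      ← (Fin.consEquiv fun _ : Fin (k + 2) => Fin d).sum_comp, Fintype.sum_prod_type]
    refine Finset.sum_congr rfl fun e _ => ?_
    rw [ih, Finset.smul_sum]
    refine Finset.sum_congr rfl fun f _ => ?_
    rw [smul_smul, Fin.prod_univ_succ]
    simp [Fin.consEquiv, ← Fin.succ_last]

/-- A labelling of a tree consists of the labels at the lowest vertex and of labellings of the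
subtrees. -/
def labellingEquiv {α β : Type*} {k : ℕ} (c : Fin k → PlanarTree α) :
    Labelling (node k c) β ≃ (β × (Fin k → β)) × (∀ j, Labelling (c j) β) where
  toFun e := ((e.down, e.up), e.sub)
  invFun x := Sum.elim (fun o : Option (Fin k) => o.elim x.1.1 x.1.2)
    fun h : Σ j, (c j).HalfEdge => x.2 h.1 h.2
  left_inv e := by
    funext h
    rcases h with (_ | j) | ⟨j, h⟩ <;> rfl
  right_inv _ := rfl

theorem sum_pi_prod_castSucc_smul {M : Type*} [AddCommMonoid M] [Module 𝕜 M] {k : ℕ}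
    {A : Fin (k + 1) → Type*} [∀ j, Fintype (A j)] (o : ∀ j : Fin k, A j.castSucc → 𝕜)
    (g : A (Fin.last k) → M) :
    ∑ x : ∀ j, A j, (∏ j, o j (x j.castSucc)) • g (x (Fin.last k)) =
      (∏ j, ∑ y, o j y) • ∑ y, g y := by
  rw [← (Fin.snocEquiv A).sum_comp, Fintype.sum_prod_type, Finset.prod_univ_sum,
    Fintype.piFinset_univ, Finset.smul_sum]
  refine Finset.sum_congr rfl fun y _ => ?_
  rw [Finset.sum_smul]
  simp [Fin.snocEquiv]

variable {K} in
-- The lowest vertex supplies the sign and the root edge the rightmost factor; b is the label of the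
-- half-edge towards the root.
theorem feynman_node (hK : IsRegularConjugateField K) (a : Fin d) (k : ℕ)
    (c : Fin (k + 1) → PlanarTree (Fin d)) :
    feynman K ⟨a, node (k + 1) c⟩ =
      -∑ b, forestSum K (List.ofFn c) [b] * K.derivWord [a, b] := by
  -- Once the labels at the lowest vertex are fixed, the subtrees are labelled independently and the
  -- sum factorises.
  have key : ∀ (b : Fin d) (f : Fin (k + 1) → Fin d),
      ∑ x : ∀ j, Labelling (c j) (Fin d),
        ((∏ j : Fin k, offPathScalar K (c j.castSucc) (f j.castSucc) (x j.castSucc)) *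
          pathScalar K (c (Fin.last k)) (x (Fin.last k))) •
        ((pathFactors K (c (Fin.last k)) (f (Fin.last k)) (x (Fin.last k))).prod *
          onePIFunctional K (b :: List.ofFn f) * K.derivWord [a, b]) =
      (∏ j : Fin k, ∑ y, offPathScalar K (c j.castSucc) (f j.castSucc) y) •
        ((∑ y, pathScalar K (c (Fin.last k)) y •
          (pathFactors K (c (Fin.last k)) (f (Fin.last k)) y).prod) *
          onePIFunctional K (b :: List.ofFn f) * K.derivWord [a, b]) := by
    intro b f
    simp_rw [mul_smul, Finset.sum_mul, smul_mul_assoc]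
    exact sum_pi_prod_castSucc_smul (A := fun j => Labelling (c j) (Fin d))
      (fun j y => offPathScalar K (c j.castSucc) (f j.castSucc) y)
      (fun y => pathScalar K (c (Fin.last k)) y •
        ((pathFactors K (c (Fin.last k)) (f (Fin.last k)) y).prod *
          onePIFunctional K (b :: List.ofFn f) * K.derivWord [a, b]))
  rw [feynman]
  simp only [pathScalar, pathFactors, prod_append_pair, numInternal]
  rw [← (labellingEquiv c).symm.sum_comp, Fintype.sum_prod_type, Fintype.sum_prod_type]
  refine (congrArg (_ • ·) (Finset.sum_congr rfl fun b _ =>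
    Finset.sum_congr rfl fun f _ => key b f)).trans ?_
  rw [Finset.smul_sum, ← Finset.sum_neg_distrib]
  refine Finset.sum_congr rfl fun b _ => ?_
  rw [forestSum_ofFn, Finset.sum_mul, Finset.smul_sum, ← Finset.sum_neg_distrib]
  refine Finset.sum_congr rfl fun f _ => ?_
  simp only [coeff_feynman_nil hK, Finset.prod_mul_distrib]
  simp only [feynman, smul_mul_assoc, smul_smul, List.singleton_append]
  rw [← neg_smul]
  congr 1
  rw [pow_add, ← Finset.prod_pow_eq_pow_sum, Fin.prod_univ_castSucc]
  ring

variable {K} in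
theorem feynman_graft (hK : IsRegularConjugateField K) (a : Fin d)
    {ts : List (PlanarTree (Fin d))} (h : ts ≠ []) :
    feynman K ⟨a, graft ts⟩ = -∑ b, forestSum K ts [b] * K.derivWord [a, b] := by
  obtain ⟨k, hk⟩ := Nat.exists_eq_succ_of_ne_zero (mt List.length_eq_zero_iff.mp h)
  obtain ⟨c, rfl⟩ : ∃ c : Fin (k + 1) → PlanarTree (Fin d), ts = List.ofFn c :=
    ⟨fun j => ts.get (j.cast hk.symm), by
      refine List.ext_getElem (by simp [hk]) fun i _ _ => by rw [List.getElem_ofFn]; rfl⟩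
  rw [graft_ofFn, feynman_node hK]

theorem feynman_leaf (a b : Fin d) : feynman K ⟨a, leaf b⟩ = K.derivWord [a, b] := by
  have : Unique (Labelling (leaf b) (Fin d)) :=
    inferInstanceAs (Unique (Empty → Fin d))
  simp [feynman, numInternal, pathScalar, pathFactors]

/-- Splitting off the first tree reproduces the sum over cuts in `derivWord_onePIFunctional`. -/
theorem finsum_properForests_forestSum (v p : List (Fin d)) :
    ∑ᶠ ts ∈ properForestsWithLeaves v, forestSum K ts p =
      ∑ k ∈ Finset.Ico 1 v.length, ∑ e,
        (∑ᶠ T ∈ treesWithLeaves (v.take k), feynman K ⟨e, T⟩).coeff [] •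
          ∑ᶠ ts ∈ forestsWithLeaves (v.drop k), forestSum K ts (p ++ [e]) := by
  rw [finsum_properForestsWithLeaves]
  refine Finset.sum_congr rfl fun k _ => ?_
  simp only [finsum_mem_eq_finite_toFinset_sum _ (finite_treesWithLeaves _),
    finsum_mem_eq_finite_toFinset_sum _ (finite_forestsWithLeaves _), coeff_sum,
    Finset.sum_smul, Finset.smul_sum]
  rw [Finset.sum_comm]
  symm
  rw [Finset.sum_comm]
  refine Finset.sum_congr rfl fun ts hts => ?_
  rw [Finset.sum_comm]
  refine Finset.sum_congr rfl fun T _ => ?_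
  exact (forestSum_cons K T ((Set.Finite.mem_toFinset _).mp hts).1 p).symm

variable {K} in
theorem finsum_feynman_and_forestSum (hK : IsRegularConjugateField K) (v : List (Fin d))
    (hv : v ≠ []) :
    (∀ a, ∑ᶠ T ∈ treesWithLeaves v, feynman K ⟨a, T⟩ = K.derivWord (a :: v)) ∧
    ∀ p, ∑ᶠ ts ∈ forestsWithLeaves v, forestSum K ts p = (onePIFunctional K p).derivWord v := by
  induction hn : v.length using Nat.strong_induction_on generalizing v with
  | _ n ih =>
  subst hn
  -- Proper forests involve only shorter words, so the induction hypothesis turns them into the sum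
  -- over cuts.
  have hproper : ∀ p, ∑ᶠ ts ∈ properForestsWithLeaves v, forestSum K ts p =
      (onePIFunctional K p).derivWord v -
        ∑ e, K.derivWord (e :: v) * onePIFunctional K (p ++ [e]) := by
    intro p
    rw [derivWord_onePIFunctional hK p hv, add_sub_cancel_left, finsum_properForests_forestSum]
    refine Finset.sum_congr rfl fun k hk => Finset.sum_congr rfl fun e _ => ?_
    rw [Finset.mem_Ico] at hk
    have h1 : (v.take k).length = k := by rw [List.length_take]; omega
    have h2 : (v.drop k).length = v.length - k := List.length_drop
    rw [(ih _ (by omega) (v.take k) (List.ne_nil_of_length_pos (by omega)) rfl).1,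
      (ih _ (by omega) (v.drop k) (List.ne_nil_of_length_pos (by omega)) rfl).2]
  have htrees : ∀ a, ∑ᶠ T ∈ treesWithLeaves v, feynman K ⟨a, T⟩ = K.derivWord (a :: v) := by
    intro a
    rcases Nat.lt_or_ge v.length 2 with h | h
    · obtain ⟨b, rfl⟩ := List.length_eq_one_iff.mp
        (le_antisymm (Nat.le_of_lt_succ h) (List.length_pos_of_ne_nil hv))
      rw [treesWithLeaves_singleton, finsum_mem_singleton, feynman_leaf]
    · have hp : ∀ b, ∑ᶠ ts ∈ properForestsWithLeaves v, forestSum K ts [b] =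
          -∑ e, K.derivWord (e :: v) * onePIFunctional K [b, e] := by
        intro b
        -- For p = b the functional is y_b, whose derivatives of order at least two vanish.
        rw [hproper, onePIFunctional_singleton hK, derivWord_X b h, zero_sub]
        rfl
      rw [finsum_treesWithLeaves h, finsum_mem_congr rfl fun ts hts =>
        feynman_graft hK a (ts := ts) hts.1.1]
      rw [finsum_mem_eq_finite_toFinset_sum _ (finite_properForestsWithLeaves v)] at *
      simp only [finsum_mem_eq_finite_toFinset_sum _ (finite_properForestsWithLeaves v)] at hp
      rw [Finset.sum_neg_distrib, Finset.sum_comm]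
      simp_rw [← Finset.sum_mul, hp, neg_mul]
      rw [Finset.sum_neg_distrib, neg_neg]
      simp_rw [Finset.sum_mul, mul_assoc]
      rw [Finset.sum_comm]
      -- The sum over b contracts the two Hessians to δ_{ea}, leaving K_{av}.
      simp_rw [← Finset.mul_sum, sum_onePIFunctional_mul hK]
      simp
  refine ⟨htrees, fun p => ?_⟩
  rw [finsum_forestsWithLeaves, hproper]
  have : ∑ᶠ T ∈ treesWithLeaves v, forestSum K [T] p =
      ∑ e, K.derivWord (e :: v) * onePIFunctional K (p ++ [e]) := by
    simp_rw [← htrees, finsum_mem_eq_finite_toFinset_sum _ (finite_treesWithLeaves v),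
      Finset.sum_mul]
    rw [Finset.sum_comm]
    rfl
  rw [this, add_sub_cancel]

end FeynmanSums

theorem mainTheorem1 {𝕜 : Type*} [Field 𝕜] [CharZero 𝕜] {A : Type*} [Ring A] [Algebra 𝕜 A]
    (φ : A →ₗ[𝕜] 𝕜) (hφ : φ 1 = 1) {d : ℕ} (a : Fin d → A)
    (K : NCSeries 𝕜 d) (hK : K = cumulantSeries (momentSeries φ a)) (hreg : IsRegularConjugateField K)
    (w : List (Fin d)) (hw : 2 ≤ w.length) :
    (admissibleTrees w).Finite ∧
    Set.BijOn RootedPlanarTree.shape (admissibleTrees w) (schroederTrees (w.length - 1)) ∧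
    K.derivWord w = ∑ᶠ T ∈ admissibleTrees w, feynman K T := by
  match w, hw with
  | i :: j :: v, _ =>
    refine ⟨?_, bijOn_shape i (j :: v), ?_⟩
    · rw [admissibleTrees_cons]
      exact (PlanarTree.finite_treesWithLeaves _).image _
    · rw [admissibleTrees_cons, finsum_mem_image fun T _ T' _ h => (RootedPlanarTree.mk.inj h).2]
      exact ((finsum_feynman_and_forestSum hreg _ (List.cons_ne_nil j v)).1 i).symm
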